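/- Let $V$ be a countably infinite set, let $b:V\times V\to[0,\infty)$ satisfy $b(x,x)=0$, and let $m:V\to(0,\infty)$. There is a directed edge $(x,y)\in\vec E$ exactly when $b(x,y)>0$. Assume that the directed graph $G=(V,\vec E,b)$ is locally finite (every vertex has finitely many in- and out-neighbours) and connected (any two vertices are joined by a chain of edges, whose orientations may be disregarded). Put $\beta^+(x)=\sum_{y}b(x,y)$ and $\beta^-(x)=\sum_y b(y,x)$, and assume that $\beta^+(x)=\beta^-(x)>0$ for all $x\in V$. On the Hilbert space $\ell^2(V,m)$ with norm $\|f\|_m^2=\sum_x m(x)|f(x)|^2$ consider the operator $\Delta$ whose domain is the space of finitely supported functions $f:V\to\mathbb C$, given by $$\Delta f(x)=\frac1{m(x)}\sum_{y\in V}b(x,y)\,(f(x)-f(y)).$$ For a closed operator $T$ let $\sigma_{ess}(T)$ be the set of $\lambda\in\mathbb C$ for which the range of $T-\lambda$ is not closed or $\dim\ker(T-\lambda)=\infty$, and let $\eta^{ess}(T)=\inf\{\mathrm{Re}\,\lambda:\lambda\in\sigma_{ess}(T)\}\in[-\infty,\infty]$, with $\inf\emptyset=+\infty$. For $\Omega\subset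 V$ let $$h(\Omega)=\inf_U\frac{b(\partial_E U)}{\sum_{x\in U}m(x)},\quad \tilde h(\Omega)=\inf_U\frac{b(\partial_E U)}{\sum_{x\in U}\beta^+(x)},\quad m_\Omega=\inf_{x\in\Omega}\frac{\beta^+(x)}{m(x)},\quad M_\Omega=\sup_{x\in\Omega}\frac{\beta^+(x)}{m(x)},$$ where $U$ runs over the finite non-empty subsets of $\Omega$ and $b(\partial_EU)$ is the sum of $b(x,y)$ over all directed edges $(x,y)$ with exactly one endpoint in $U$. Let $(V_n)_{n\in\mathbb N}$ be an increasing sequence of finite sets of vertices that induce connected subgraphs, with $\bigcup_nV_n=V$, and let $$h_\infty=\lim_n h(V_n^c),\quad \tilde h_\infty=\lim_n\tilde h(V_n^c),\quad m_\infty=\lim_n m_{V_n^c},\quad M_\infty=\lim_n M_{V_n^c};$$ these limits exist in $[0,\infty]$ by monotonicity. Then $\Delta$ is closable, and its closure $\overline\Delta$ satisfies $$\frac{h_\infty^2}{8}\le M_\infty\,\eta^{ess}(\overline\Delta),$$ except when the right-hand side is the indeterminate product $\infty\cdot 0$ (that is, when $M_\infty=\infty$ and $\eta^{ess}(\overline\Delta)=0$),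 in which case this inequality asserts nothing; and $$m_\infty\,\frac{\tilde h_\infty^2}{8}\le\eta^{ess}(\overline\Delta).$$ In both inequalities $0\cdot\infty=0$. -/

import Mathlib

open MeasureTheory Filter Topology
open scoped NNReal ENNReal

noncomputable section

/-- A locally finite directed weighted graph without loops on the vertex set `V`:
edge weights `b` (there is an edge from `x` to `y` iff `b x y > 0`) and a positive measure `m`
on the vertices. -/
structure WeightedDigraph (V : Type*) where
  b : V → V → ℝ≥0
  m : V → ℝ≥0
  b_self : ∀ x, b x x = 0
  m_pos : ∀ x, 0 < m x
  locallyFinite : ∀ x, {y | 0 < b x y ∨ 0 < b y x}.Finite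

namespace WeightedDigraph

variable {V : Type*} (G : WeightedDigraph V)

/-- `{x, y}` is an undirected edge. -/
def Adj (x y : V) : Prop := 0 < G.b x y ∨ 0 < G.b y x

/-- The subgraph induced on `S` is connected: any two vertices of `S` are joined by a chain of
edges inside `S` (edges may be traversed in both directions). -/
def ConnectedOn (S : Set V) : Prop :=
  ∀ x ∈ S, ∀ y ∈ S, Relation.ReflTransGen (fun u v => u ∈ S ∧ v ∈ S ∧ G.Adj u v) x y

/-- `β⁺(x) = ∑_y b(x,y)`. -/
def betaOut (x : V) : ℝ≥0 := ∑' y, G.b x y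

/-- `β⁻(x) = ∑_y b(y,x)`. -/
def betaIn (x : V) : ℝ≥0 := ∑' y, G.b y x

/-- The edge boundary: directed edges with exactly one endpoint in `U`. -/
def edgeBoundary (U : Set V) : Set (V × V) :=
  {e | 0 < G.b e.1 e.2 ∧ ((e.1 ∈ U ∧ e.2 ∉ U) ∨ (e.1 ∉ U ∧ e.2 ∈ U))}

/-- `b(∂_E U)`. -/
def boundaryWeight (U : Set V) : ℝ≥0∞ := ∑' e : G.edgeBoundary U, (G.b e.1.1 e.1.2 : ℝ≥0∞)

/-- The Cheeger constant `h(Ω) = inf b(∂_E U) / m(U)` over finite nonempty `U ⊆ Ω`. -/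
def cheeger (Ω : Set V) : ℝ≥0∞ :=
  ⨅ (U : Finset V) (_ : U.Nonempty) (_ : (U : Set V) ⊆ Ω),
    G.boundaryWeight U / ∑ x ∈ U, (G.m x : ℝ≥0∞)

/-- The Cheeger constant `h̃(Ω) = inf b(∂_E U) / β⁺(U)` over finite nonempty `U ⊆ Ω`. -/
def cheegerTilde (Ω : Set V) : ℝ≥0∞ :=
  ⨅ (U : Finset V) (_ : U.Nonempty) (_ : (U : Set V) ⊆ Ω),
    G.boundaryWeight U / ∑ x ∈ U, (G.betaOut x : ℝ≥0∞)

/-- `m_Ω = inf {β⁺(x) / m(x) : x ∈ Ω}`. -/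
def lowerRatio (Ω : Set V) : ℝ≥0∞ := ⨅ x ∈ Ω, (G.betaOut x : ℝ≥0∞) / G.m x

/-- `M_Ω = sup {β⁺(x) / m(x) : x ∈ Ω}`. -/
def upperRatio (Ω : Set V) : ℝ≥0∞ := ⨆ x ∈ Ω, (G.betaOut x : ℝ≥0∞) / G.m x

/-- A filtration: an increasing sequence of finite connected (induced) subgraphs, given by their
vertex sets, which exhausts the graph. -/
structure Filtration where
  vert : ℕ → Finset V
  mono : ∀ n, vert n ⊆ vert (n + 1)
  connected : ∀ n, G.ConnectedOn (vert n)
  exhausts : ⋃ n, (vert n : Set V) = Set.univ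

namespace Filtration

variable {G} (F : G.Filtration)

/-- The complement `V_nᶜ`. -/
def outer (n : ℕ) : Set V := (F.vert n : Set V)ᶜ

/-- `h_∞ = lim_n h(V_nᶜ)`. -/
def hInf : ℝ≥0∞ := limUnder atTop fun n => G.cheeger (F.outer n)

/-- `h̃_∞ = lim_n h̃(V_nᶜ)`. -/
def hTildeInf : ℝ≥0∞ := limUnder atTop fun n => G.cheegerTilde (F.outer n)

/-- `m_∞ = lim_n m_{V_nᶜ}`. -/
def mInf : ℝ≥0∞ := limUnder atTop fun n => G.lowerRatio (F.outer n)

/-- `M_∞ = lim_n M_{V_nᶜ}`. -/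
def MInf : ℝ≥0∞ := limUnder atTop fun n => G.upperRatio (F.outer n)

theorem outer_antitone : Antitone F.outer :=
  antitone_nat_of_succ_le fun n =>
    Set.compl_subset_compl.2 (Finset.coe_subset.2 (F.mono n))

/-! All four limits exist in `[0,∞]`, so that the values above are genuine limits. -/

theorem tendsto_hInf : Tendsto (fun n => G.cheeger (F.outer n)) atTop (𝓝 F.hInf) := by
  have h : Monotone fun n => G.cheeger (F.outer n) := fun i j hij =>
    iInf_mono fun U => iInf_mono fun _ => iInf_mono' fun hU =>
      ⟨hU.trans (F.outer_antitone hij), le_rfl⟩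
  exact tendsto_nhds_limUnder ⟨_, tendsto_atTop_iSup h⟩

theorem tendsto_hTildeInf :
    Tendsto (fun n => G.cheegerTilde (F.outer n)) atTop (𝓝 F.hTildeInf) := by
  have h : Monotone fun n => G.cheegerTilde (F.outer n) := fun i j hij =>
    iInf_mono fun U => iInf_mono fun _ => iInf_mono' fun hU =>
      ⟨hU.trans (F.outer_antitone hij), le_rfl⟩
  exact tendsto_nhds_limUnder ⟨_, tendsto_atTop_iSup h⟩

theorem tendsto_mInf : Tendsto (fun n => G.lowerRatio (F.outer n)) atTop (𝓝 F.mInf) := by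
  have h : Monotone fun n => G.lowerRatio (F.outer n) := fun i j hij =>
    biInf_mono fun _ hx => F.outer_antitone hij hx
  exact tendsto_nhds_limUnder ⟨_, tendsto_atTop_iSup h⟩

theorem tendsto_MInf : Tendsto (fun n => G.upperRatio (F.outer n)) atTop (𝓝 F.MInf) := by
  have h : Antitone fun n => G.upperRatio (F.outer n) := fun i j hij =>
    biSup_mono fun _ hx => F.outer_antitone hij hx
  exact tendsto_nhds_limUnder ⟨_, tendsto_atTop_iInf h⟩

end Filtration

/-- The action of the Laplacian on functions:
`Δ f (x) = (1 / m(x)) ∑_y b(x,y) (f(x) - f(y))`. -/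
def lapFun (f : V → ℂ) (x : V) : ℂ :=
  (1 / ((G.m x : ℝ) : ℂ)) * ∑' y, ((G.b x y : ℝ) : ℂ) * (f x - f y)

theorem summable_lap (f : V → ℂ) (x : V) :
    Summable fun y => ((G.b x y : ℝ) : ℂ) * (f x - f y) := by
  refine summable_of_hasFiniteSupport ((G.locallyFinite x).subset fun y hy => ?_)
  left
  by_contra h
  have h0 : G.b x y = 0 := by simpa using h
  simp [h0] at hy

theorem lapFun_add (f g : V → ℂ) : G.lapFun (f + g) = G.lapFun f + G.lapFun g := by
  funext x
  simp only [lapFun, Pi.add_apply]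
  rw [← mul_add, ← (G.summable_lap f x).tsum_add (G.summable_lap g x)]
  congr 2
  funext y
  ring

theorem lapFun_smul (c : ℂ) (f : V → ℂ) : G.lapFun (c • f) = c • G.lapFun f := by
  funext x
  simp only [lapFun, Pi.smul_apply, smul_eq_mul]
  rw [mul_left_comm, ← tsum_mul_left (a := c)]
  congr 2
  funext y
  ring

theorem lapFun_finite_support {f : V → ℂ} (hf : (Function.support f).Finite) :
    (Function.support (G.lapFun f)).Finite := by
  refine (hf.union (hf.biUnion fun x _ => G.locallyFinite x)).subset fun x hx => ?_
  by_contra hn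
  simp only [Set.mem_union, Set.mem_iUnion, not_or, not_exists] at hn
  obtain ⟨h1, h2⟩ := hn
  have hfx : f x = 0 := by simpa using h1
  apply hx
  have : ∀ y, ((G.b x y : ℝ) : ℂ) * (f x - f y) = 0 := by
    intro y
    by_cases hy : f y = 0
    · simp [hfx, hy]
    · have := h2 y hy
      have h0 : G.b x y = 0 := by
        by_contra hb
        exact this (Or.inr (pos_iff_ne_zero.2 hb))
      simp [h0]
  simp [lapFun, this]

section Hilbert

variable [MeasurableSpace V] [DiscreteMeasurableSpace V]

/-- The measure on `V` with mass `m(x)` at each vertex `x`. -/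
def vertexMeasure : Measure V := Measure.sum fun x => (G.m x : ℝ≥0∞) • Measure.dirac x

/-- The Hilbert space `ℓ²(V, m)`; its squared norm is `∑_x m(x) |f(x)|²`. -/
abbrev L2 : Type _ := Lp ℂ 2 G.vertexMeasure

theorem eq_of_ae_eq {f g : V → ℂ} (h : f =ᵐ[G.vertexMeasure] g) : f = g := by
  funext x
  have h1 := Measure.ae_sum_iff' (DiscreteMeasurableSpace.forall_measurableSet _) |>.1 h x
  have hm : (G.m x : ℝ≥0∞) ≠ 0 := by exact_mod_cast (G.m_pos x).ne'
  rw [Measure.ae_ennreal_smul_measure_iff hm] at h1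
  simpa [ae_dirac_iff (DiscreteMeasurableSpace.forall_measurableSet _)] using h1

theorem memLp_of_finite_support {f : V → ℂ} (hf : (Function.support f).Finite) :
    MemLp f 2 G.vertexMeasure := by
  refine ⟨(Measurable.of_discrete).aestronglyMeasurable, ?_⟩
  rw [eLpNorm_lt_top_iff_lintegral_rpow_enorm_lt_top (by norm_num) (by norm_num)]
  simp only [vertexMeasure, lintegral_sum_measure, lintegral_smul_measure, lintegral_dirac]
  rw [tsum_eq_sum (s := hf.toFinset)]
  · refine ENNReal.sum_lt_top.2 fun x _ => ?_
    exact ENNReal.mul_lt_top ENNReal.coe_lt_top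
      (ENNReal.rpow_lt_top_of_nonneg (by norm_num) enorm_ne_top)
  · intro x hx
    have : f x = 0 := by simpa using hx
    simp [this]

/-- `C_c(V)`, the finitely supported functions, as a subspace of `ℓ²(V, m)`. -/
def Cc : Submodule ℂ G.L2 where
  carrier := {f | (Function.support (f : V → ℂ)).Finite}
  zero_mem' := by
    have : ((0 : G.L2) : V → ℂ) = 0 := G.eq_of_ae_eq (Lp.coeFn_zero ℂ 2 _)
    rw [Set.mem_ofPred_eq, this, Function.support_zero]
    exact Set.finite_empty
  add_mem' := by
    intro f g hf hg
    have : ((f + g : G.L2) : V → ℂ) = f + g := G.eq_of_ae_eq (Lp.coeFn_add f g)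
    simp only [Set.mem_ofPred_eq, this]
    exact (Set.Finite.union hf hg).subset (Function.support_add _ _)
  smul_mem' := by
    intro c f hf
    have : ((c • f : G.L2) : V → ℂ) = c • f := G.eq_of_ae_eq (Lp.coeFn_smul c f)
    simp only [Set.mem_ofPred_eq, this]
    exact Set.Finite.subset hf (Function.support_const_smul_subset c _)

/-- The Laplacian `Δ` as an unbounded operator in `ℓ²(V, m)` with domain `C_c(V)`. -/
def laplacian : G.L2 →ₗ.[ℂ] G.L2 where
  domain := G.Cc
  toFun :=
    { toFun := fun f =>
        (G.memLp_of_finite_support (G.lapFun_finite_support f.2)).toLp (G.lapFun (f : G.L2))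
      map_add' := by
        intro f g
        rw [← MemLp.toLp_add]
        refine (MemLp.toLp_eq_toLp_iff _ _).2 (Eventually.of_forall fun x => ?_)
        have : (((f + g : G.Cc) : G.L2) : V → ℂ) = (f : G.L2) + (g : G.L2) :=
          G.eq_of_ae_eq (Lp.coeFn_add (f : G.L2) (g : G.L2))
        rw [this, lapFun_add]
      map_smul' := by
        intro c f
        rw [RingHom.id_apply, ← MemLp.toLp_const_smul]
        refine (MemLp.toLp_eq_toLp_iff _ _).2 (Eventually.of_forall fun x => ?_)
        have : (((c • f : G.Cc) : G.L2) : V → ℂ) = c • (f : G.L2) :=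
          G.eq_of_ae_eq (Lp.coeFn_smul c (f : G.L2))
        rw [this, lapFun_smul] }

end Hilbert

end WeightedDigraph

/-- The operator `T - lam`, defined on the domain of `T`. -/
def subScalar {H : Type*} [NormedAddCommGroup H] [InnerProductSpace ℂ H]
    (T : H →ₗ.[ℂ] H) (lam : ℂ) : T.domain →ₗ[ℂ] H :=
  T.toFun - lam • T.domain.subtype

/-- The essential spectrum: all `lam` for which the range of `T - lam` is not closed or the kernel
of `T - lam` is infinite dimensional. -/
def essSpectrum {H : Type*} [NormedAddCommGroup H] [InnerProductSpace ℂ H]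
    (T : H →ₗ.[ℂ] H) : Set ℂ :=
  {lam | ¬ IsClosed ((subScalar T lam).range : Set H) ∨
    ¬ FiniteDimensional ℂ (subScalar T lam).ker}

/-- `η^ess(T) = inf {Re lam : lam ∈ σ_ess(T)}` in `[-∞,∞]`; it is `+∞` if `σ_ess(T)` is empty. -/
def etaEss {H : Type*} [NormedAddCommGroup H] [InnerProductSpace ℂ H]
    (T : H →ₗ.[ℂ] H) : EReal :=
  ⨅ lam ∈ essSpectrum T, ((lam.re : ℝ) : EReal)

end

open MeasureTheory Filter Topology
open scoped NNReal ENNReal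

noncomputable section

/-! Since in- and out-weights agree at every vertex, the first-order terms in `Re ⟨g, Δg⟩` cancel
and leave half the Dirichlet sum of `b(x,y)|g(x) - g(y)|²`, although `Δ` need not be symmetric.
Cheeger's argument then applies: the coarea inequality for `|g|²` bounds `c ∑ w|g|²` by `∑ b |
|g(x)|² - |g(y)|² |`, and Cauchy–Schwarz bounds the square of that by `8 Re ⟨g, Δg⟩ ∑ β⁺|g|²`
(`weightedCheeger_sq_le`). The weights `w = m` and `w = β⁺` give the two form bounds for functions
supported off a finite set.

The link to the essential spectrum is `notMem_essSpectrum_closure`: a lower bound for `Δ - λ` on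
functions vanishing on a finite set survives closure, and the finitely many remaining dimensions
spoil neither closedness of the range nor finiteness of the kernel. Hence each essential `λ` has
approximate eigenfunctions off every `V_n`, and `Re λ` inherits the form bounds there. It remains to
let `n → ∞` and take the infimum over `λ`. -/

/-! ### Finite inequalities behind Cheeger's estimate. -/

/-- Discrete coarea inequality. -/
theorem coarea_inequality {V : Type*} (T : Finset V) {b : V → V → ℝ} (w : V → ℝ) (h : ℝ)
    (S : Finset V)
    (H : ∀ U ⊆ S, U.Nonempty → h * ∑ x ∈ U, w x ≤ ∑ x ∈ T, ∑ y ∈ T, b x y *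
      |(U : Set V).indicator 1 x - (U : Set V).indicator (1 : V → ℝ) y|)
    (u : V → ℝ) (hu : ∀ x, 0 ≤ u x) (hS : ∀ x ∉ S, u x = 0) :
    h * ∑ x ∈ S, w x * u x ≤ ∑ x ∈ T, ∑ y ∈ T, b x y * |u x - u y| := by
  classical
  -- Layer-cake by induction: subtracting the minimum of `u` on `S` times the indicator of `S` kills
  -- a vertex, so the remainder lives on a smaller set.
  induction S using Finset.strongInduction generalizing u with
  | H S ih =>
  rcases S.eq_empty_or_nonempty with rfl | hne
  · have : ∀ x, u x = 0 := fun x => hS x (by simp)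
    simp [this]
  obtain ⟨x₀, hx₀, hmin⟩ := S.exists_min_image u hne
  let χ : V → ℝ := (S : Set V).indicator 1
  have hχ : ∀ x ∈ S, χ x = 1 := fun x hx => by simp [χ, hx]
  have hχ' : ∀ x ∉ S, χ x = 0 := fun x hx => by simp [χ, hx]
  let v : V → ℝ := fun x => u x - u x₀ * χ x
  have hv0 : ∀ x, 0 ≤ v x := fun x => by
    by_cases hx : x ∈ S
    · simpa [v, hχ x hx] using hmin x hx
    · simpa [v, hχ' x hx] using hu x
  have hvS : ∀ x ∉ S.erase x₀, v x = 0 := fun x hx => by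
    by_cases hxS : x ∈ S
    · have : x = x₀ := by_contra fun hxx => hx (Finset.mem_erase.2 ⟨hxx, hxS⟩)
      subst this
      simp [v, hχ x hxS]
    · simp [v, hχ' x hxS, hS x hxS]
  have key := ih (S.erase x₀) (Finset.erase_ssubset hx₀)
    (fun U hU => H U (hU.trans (Finset.erase_subset _ _))) v hv0 hvS
  -- Absolute values add because the differences of `v` and of `χ` never have opposite signs.
  have hsplit : ∀ x y, |u x - u y| = |v x - v y| + u x₀ * |χ x - χ y| := by
    intro x y
    have h0 := hu x₀
    have hvx := hv0 x
    have hvy := hv0 y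
    by_cases hx : x ∈ S <;> by_cases hy : y ∈ S
    · simp [v, hχ x hx, hχ y hy]
    · simp only [v, hχ x hx, hχ' y hy, hS y hy] at hvx hvy ⊢
      have := hmin x hx
      rw [abs_of_nonneg (by linarith), abs_of_nonneg (by linarith), abs_of_nonneg (by norm_num)]
      ring
    · simp only [v, hχ' x hx, hχ y hy, hS x hx] at hvx hvy ⊢
      have := hmin y hy
      rw [abs_of_nonpos (by linarith), abs_of_nonpos (by linarith), abs_of_nonpos (by norm_num)]
      ring
    · simp [v, hχ' x hx, hχ' y hy]
  have hlhs : ∑ x ∈ S, w x * u x = ∑ x ∈ S.erase x₀, w x * v x + u x₀ * ∑ x ∈ S, w x := by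
    rw [Finset.sum_erase S (f := fun x => w x * v x) (by simp [v, hχ x₀ hx₀]), Finset.mul_sum,
      ← Finset.sum_add_distrib]
    refine Finset.sum_congr rfl fun x hx => ?_
    simp only [v, hχ x hx]
    ring
  have hrhs : ∑ x ∈ T, ∑ y ∈ T, b x y * |u x - u y| =
      ∑ x ∈ T, ∑ y ∈ T, b x y * |v x - v y| +
        u x₀ * ∑ x ∈ T, ∑ y ∈ T, b x y * |χ x - χ y| := by
    simp only [hsplit, mul_add, Finset.sum_add_distrib, Finset.mul_sum]
    simp only [mul_left_comm]
  rw [hlhs, hrhs, mul_add, mul_left_comm]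
  exact add_le_add key (mul_le_mul_of_nonneg_left (H S subset_rfl hne) (hu x₀))

/-- Green's formula for a finite weighted digraph which is balanced on the support of `g`. -/
theorem green_formula {V : Type*} (T : Finset V) (b : V → V → ℝ) (β : V → ℝ) (g : V → ℂ)
    (hout : ∀ x ∈ T, g x ≠ 0 → ∑ y ∈ T, b x y = β x)
    (hin : ∀ x ∈ T, g x ≠ 0 → ∑ y ∈ T, b y x = β x) :
    ∑ x ∈ T, (starRingEnd ℂ (g x) * ∑ y ∈ T, (b x y : ℂ) * (g x - g y)).re =
      1 / 2 * ∑ x ∈ T, ∑ y ∈ T, b x y * ‖g x - g y‖ ^ 2 := by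
  -- The second term is antisymmetric in the norms; balance makes its double sum vanish.
  have hpt : ∀ x y, (starRingEnd ℂ (g x) * ((b x y : ℂ) * (g x - g y))).re =
      1 / 2 * (b x y * ‖g x - g y‖ ^ 2) +
        1 / 2 * (b x y * ‖g x‖ ^ 2 - b x y * ‖g y‖ ^ 2) := by
    intro x y
    simp only [← Complex.normSq_eq_norm_sq, Complex.normSq_apply, Complex.mul_re, Complex.mul_im,
      Complex.conj_re, Complex.conj_im, Complex.sub_re, Complex.sub_im, Complex.ofReal_re,
      Complex.ofReal_im]
    ring
  have h1 : ∑ x ∈ T, ∑ y ∈ T, b x y * ‖g x‖ ^ 2 = ∑ x ∈ T, β x * ‖g x‖ ^ 2 := by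
    refine Finset.sum_congr rfl fun x hx => ?_
    by_cases h : g x = 0
    · simp [h]
    · rw [← Finset.sum_mul, hout x hx h]
  have h2 : ∑ x ∈ T, ∑ y ∈ T, b x y * ‖g y‖ ^ 2 = ∑ x ∈ T, β x * ‖g x‖ ^ 2 := by
    rw [Finset.sum_comm]
    refine Finset.sum_congr rfl fun x hx => ?_
    by_cases h : g x = 0
    · simp [h]
    · rw [← Finset.sum_mul, hin x hx h]
  simp only [Finset.mul_sum, Complex.re_sum, hpt, Finset.sum_add_distrib]
  simp only [← Finset.mul_sum, Finset.sum_sub_distrib, h1, h2]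
  ring

/-- The Cauchy–Schwarz step in Cheeger's inequality. -/
theorem sq_sum_abs_sub_le {V : Type*} (T : Finset V) (b : V → V → ℝ) (β : V → ℝ) (g : V → ℂ)
    (hb : ∀ x y, 0 ≤ b x y)
    (hout : ∀ x ∈ T, g x ≠ 0 → ∑ y ∈ T, b x y = β x)
    (hin : ∀ x ∈ T, g x ≠ 0 → ∑ y ∈ T, b y x = β x) :
    (∑ x ∈ T, ∑ y ∈ T, b x y * |‖g x‖ ^ 2 - ‖g y‖ ^ 2|) ^ 2 ≤
      (∑ x ∈ T, ∑ y ∈ T, b x y * ‖g x - g y‖ ^ 2) * (4 * ∑ x ∈ T, β x * ‖g x‖ ^ 2) := by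
  have h1 : ∑ x ∈ T, ∑ y ∈ T, b x y * ‖g x‖ ^ 2 = ∑ x ∈ T, β x * ‖g x‖ ^ 2 := by
    refine Finset.sum_congr rfl fun x hx => ?_
    by_cases h : g x = 0
    · simp [h]
    · rw [← Finset.sum_mul, hout x hx h]
  have h2 : ∑ x ∈ T, ∑ y ∈ T, b x y * ‖g y‖ ^ 2 = ∑ x ∈ T, β x * ‖g x‖ ^ 2 := by
    rw [Finset.sum_comm]
    refine Finset.sum_congr rfl fun x hx => ?_
    by_cases h : g x = 0
    · simp [h]
    · rw [← Finset.sum_mul, hin x hx h]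
  have h3 : 4 * ∑ x ∈ T, β x * ‖g x‖ ^ 2 =
      ∑ x ∈ T, ∑ y ∈ T, (2 * (b x y * ‖g x‖ ^ 2) + 2 * (b x y * ‖g y‖ ^ 2)) := by
    simp only [Finset.sum_add_distrib, ← Finset.mul_sum, h1, h2]
    ring
  rw [h3]
  simp only [← Finset.sum_product']
  refine Finset.sum_sq_le_sum_mul_sum_of_sq_le_mul _ (fun p _ => mul_nonneg (hb _ _) (sq_nonneg _))
    (fun p _ => ?_) (fun p _ => ?_)
  · have := hb p.1 p.2
    positivity
  · have hsub : (‖g p.1‖ - ‖g p.2‖) ^ 2 ≤ ‖g p.1 - g p.2‖ ^ 2 := by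
      rw [← sq_abs (‖g p.1‖ - ‖g p.2‖)]
      exact pow_le_pow_left₀ (abs_nonneg _) (abs_norm_sub_norm_le _ _) 2
    have hadd : (‖g p.1‖ + ‖g p.2‖) ^ 2 ≤ 2 * ‖g p.1‖ ^ 2 + 2 * ‖g p.2‖ ^ 2 := by
      nlinarith [sq_nonneg (‖g p.1‖ - ‖g p.2‖)]
    calc (b p.1 p.2 * |‖g p.1‖ ^ 2 - ‖g p.2‖ ^ 2|) ^ 2
        = b p.1 p.2 ^ 2 * ((‖g p.1‖ - ‖g p.2‖) ^ 2 * (‖g p.1‖ + ‖g p.2‖) ^ 2) := by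
          rw [mul_pow, sq_abs]
          ring
      _ ≤ b p.1 p.2 ^ 2 *
          (‖g p.1 - g p.2‖ ^ 2 * (2 * ‖g p.1‖ ^ 2 + 2 * ‖g p.2‖ ^ 2)) := by gcongr
      _ = _ := by ring

/-! ### Stability of the essential spectrum under finite rank cutoffs. -/

/-- If `T₀ - lam` is bounded below on the kernel of a finite rank projection onto a subspace of the
domain of `T₀`, then `lam` is not in the essential spectrum of the closure of `T₀`. -/
theorem notMem_essSpectrum_closure {H : Type*} [NormedAddCommGroup H] [InnerProductSpace ℂ H]
    [CompleteSpace H] {T₀ : H →ₗ.[ℂ] H} (hT : T₀.IsClosable) (P : H →L[ℂ] H)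
    [FiniteDimensional ℂ P.range] (hPP : ∀ f, P (P f) = P f) (hP : ∀ f, P f ∈ T₀.domain)
    (lam : ℂ) {ε : ℝ} (hε : 0 < ε)
    (hbd : ∀ g : T₀.domain, P g = 0 → ε * ‖(g : H)‖ ≤ ‖T₀ g - lam • (g : H)‖) :
    lam ∉ essSpectrum T₀.closure := by
  -- The operator `T₀ P` is bounded.
  obtain ⟨L, hL⟩ : ∃ L : P.range →L[ℂ] H, ∀ f, L ⟨P f, f, rfl⟩ = T₀ ⟨P f, hP f⟩ := by
    have hle : P.range ≤ T₀.domain := by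
      rintro _ ⟨f, rfl⟩
      exact hP f
    exact ⟨(T₀.toFun ∘ₗ Submodule.inclusion hle).toContinuousLinearMap, fun f => rfl⟩
  let Pr : H →L[ℂ] P.range := P.codRestrict P.range fun f => ⟨f, rfl⟩
  have hPr : ∀ f, L (Pr f) = T₀ ⟨P f, hP f⟩ := fun f => hL f
  have hgr : T₀.closure.graph = T₀.graph.topologicalClosure :=
    hT.graph_closure_eq_closure_graph.symm
  -- Replacing `T₀ P` by the bounded `L` turns the lower bound for `f - P f` into a closed condition
  -- on pairs, so it passes from the graph to its closure.
  have hext : ∀ p ∈ T₀.closure.graph,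
      ε * ‖p.1 - P p.1‖ ≤ ‖(p.2 - L (Pr p.1)) - lam • (p.1 - P p.1)‖ := by
    rw [hgr]
    have hcl : IsClosed {p : H × H |
        ε * ‖p.1 - P p.1‖ ≤ ‖(p.2 - L (Pr p.1)) - lam • (p.1 - P p.1)‖} :=
      isClosed_le (by fun_prop) (by fun_prop)
    intro p hp
    refine closure_minimal ?_ hcl hp
    intro q hq
    obtain ⟨f, hf1, hf2⟩ := (LinearPMap.mem_graph_iff _).1 hq
    have := hbd (f - ⟨P f, hP f⟩) (by simp [hPP])
    rw [LinearPMap.map_sub, ← hPr] at this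
    simpa [hf1, hf2] using this
  have hclosed : IsClosed (T₀.closure.graph : Set (H × H)) := hT.closure_isClosed
  have hle : ∀ f, P f ∈ T₀.closure.domain := fun f => T₀.le_closure.1 (hP f)
  have hTP : ∀ f, T₀.closure ⟨P f, hle f⟩ = L (Pr f) := fun f => by
    rw [hPr]
    exact (T₀.le_closure.2 rfl).symm
  rintro (hran | hker)
  · apply hran
    -- The graph over `ker P` is complete, and there `T - lam` becomes a bounded map; being bounded
    -- below it has closed range.
    let Γ : Submodule ℂ (H × H) := T₀.closure.graph ⊓ (P.toLinearMap ∘ₗ LinearMap.fst ℂ H H).ker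
    have hΓ : IsClosed (Γ : Set (H × H)) := by
      refine IsClosed.inter hclosed ?_
      have : IsClosed {p : H × H | P p.1 = 0} := isClosed_eq (by fun_prop) (by fun_prop)
      exact this
    have : CompleteSpace Γ := hΓ.completeSpace_coe
    let Φ : Γ →L[ℂ] H :=
      (ContinuousLinearMap.snd ℂ H H - lam • ContinuousLinearMap.fst ℂ H H).comp Γ.subtypeL
    have hΦ : ∀ p : Γ, Φ p = p.1.2 - lam • p.1.1 := fun p => rfl
    -- Large enough for both components of the max norm: `‖f‖ ≤ ε⁻¹‖Φ‖` and `‖T f‖ ≤ (1 + ‖lam‖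
    -- ε⁻¹)‖Φ‖`.
    let C : ℝ≥0 := 1 + (1 + ‖lam‖₊) * (Real.toNNReal ε⁻¹)
    have hanti : AntilipschitzWith C Φ := by
      refine AddMonoidHomClass.antilipschitz_of_bound Φ fun p => ?_
      have hp0 : P p.1.1 = 0 := p.2.2
      have hPrp : Pr p.1.1 = 0 := Subtype.ext hp0
      have h1 := hext p.1 p.2.1
      rw [hPrp, hp0, map_zero, sub_zero, sub_zero, ← hΦ] at h1
      have h1' : ‖p.1.1‖ ≤ ε⁻¹ * ‖Φ p‖ := by
        rw [inv_mul_eq_div, le_div_iff₀' hε]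
        exact h1
      have h2 : ‖p.1.2‖ ≤ ‖Φ p‖ + ‖lam‖ * ‖p.1.1‖ := by
        have : p.1.2 = Φ p + lam • p.1.1 := by rw [hΦ]; abel
        rw [← norm_smul]
        exact (congrArg norm this).le.trans (norm_add_le _ _)
      have hC : (C : ℝ) = 1 + (1 + ‖lam‖) * ε⁻¹ := by
        simp [C, Real.coe_toNNReal _ (inv_pos.2 hε).le]
      have h0 := norm_nonneg (Φ p)
      have hi := inv_pos.2 hε
      have hl := norm_nonneg lam
      have h3 := mul_le_mul_of_nonneg_left h1' hl
      rw [hC]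
      change max ‖p.1.1‖ ‖p.1.2‖ ≤ _
      refine max_le ?_ ?_
      · have : 0 ≤ ‖lam‖ * ε⁻¹ * ‖Φ p‖ := by positivity
        nlinarith
      · have : 0 ≤ ε⁻¹ * ‖Φ p‖ := by positivity
        nlinarith
    have hΦc : IsClosed (Φ.range : Set H) := by
      have := hanti.isClosed_range Φ.uniformContinuous
      rwa [LinearMap.coe_range]
    let K : Submodule ℂ H := (L.toLinearMap - lam • P.range.subtype).range
    -- Splitting `f = (f - P f) + P f` shows that the full range is a closed subspace plus a finite
    -- dimensional one.
    have hsum : (subScalar T₀.closure lam).range = Φ.range ⊔ K := by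
      apply le_antisymm
      · rintro _ ⟨f, rfl⟩
        have hmem : ((f : H) - P f, T₀.closure f - L (Pr f)) ∈ Γ := by
          refine ⟨?_, ?_⟩
          · refine (LinearPMap.mem_graph_iff _).2 ⟨f - ⟨P f, hle f⟩, rfl, ?_⟩
            rw [LinearPMap.map_sub, hTP]
          · simp [hPP]
        refine Submodule.mem_sup.2 ⟨Φ ⟨_, hmem⟩, ⟨_, rfl⟩,
          (L.toLinearMap - lam • P.range.subtype) (Pr f), ⟨_, rfl⟩, ?_⟩
        rw [hΦ]
        change (T₀.closure f - L (Pr f)) - lam • ((f : H) - P f) + (L (Pr f) - lam • P f) =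
          T₀.closure f - lam • (f : H)
        rw [smul_sub]
        abel
      · refine sup_le ?_ ?_
        · rintro _ ⟨p, rfl⟩
          obtain ⟨f, hf1, hf2⟩ := (LinearPMap.mem_graph_iff _).1 p.2.1
          refine ⟨f, ?_⟩
          change T₀.closure f - lam • (f : H) = p.1.2 - lam • p.1.1
          rw [hf1, hf2]
        · rintro _ ⟨⟨_, f, rfl⟩, rfl⟩
          refine ⟨⟨P f, hle f⟩, ?_⟩
          change T₀.closure ⟨P f, hle f⟩ - lam • P f = L (Pr f) - lam • P f
          rw [hTP]
    rw [hsum]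
    exact Submodule.isClosed_sup_finiteDimensional _ _ hΦc
  · apply hker
    -- An eigenvector in `ker P` vanishes by the lower bound, so `P` embeds the eigenspace in its
    -- finite dimensional range.
    let Q : (subScalar T₀.closure lam).ker →ₗ[ℂ] P.range :=
      Pr.toLinearMap ∘ₗ T₀.closure.domain.subtype ∘ₗ (subScalar T₀.closure lam).ker.subtype
    refine Module.Finite.of_injective Q ((injective_iff_map_eq_zero Q).2 fun f hf => ?_)
    have hPrf : Pr (f : T₀.closure.domain) = 0 := hf
    have hPf : P (f : T₀.closure.domain) = 0 := congrArg Subtype.val hPrf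
    have hfk : T₀.closure f.1 - lam • (f.1 : H) = 0 := f.2
    have h1 := hext _ (T₀.closure.mem_graph f.1)
    simp only [hPrf, hPf, map_zero, sub_zero, hfk, norm_zero] at h1
    have h2 : ‖(f.1 : H)‖ = 0 := le_antisymm (by nlinarith) (norm_nonneg _)
    exact Subtype.ext (Subtype.ext (norm_eq_zero.1 h2))

namespace WeightedDigraph

variable {V : Type*} (G : WeightedDigraph V)

/-! ### Point evaluations, cutoffs and closability. -/

theorem ofReal_m_ne_zero (x : V) : ((G.m x : ℝ) : ℂ) ≠ 0 := by
  exact_mod_cast (G.m_pos x).ne'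

/-- `lapFun` as a finite sum. -/
theorem lapFun_eq_sum (f : V → ℂ) {x : V} {T : Finset V} (hT : ∀ y ∉ T, G.b x y = 0) :
    G.lapFun f x = (1 / ((G.m x : ℝ) : ℂ)) * ∑ y ∈ T, ((G.b x y : ℝ) : ℂ) * (f x - f y) := by
  rw [lapFun, tsum_eq_sum (s := T)]
  intro y hy
  simp [hT y hy]

theorem L2_ext [MeasurableSpace V] {f g : G.L2} (h : ∀ x, f x = g x) : f = g :=
  Lp.ext (Eventually.of_forall h)

section Hilbert

variable [MeasurableSpace V] [DiscreteMeasurableSpace V]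

theorem vertexMeasure_singleton (x : V) : G.vertexMeasure {x} = G.m x := by
  classical
  rw [vertexMeasure, Measure.sum_apply _ (DiscreteMeasurableSpace.forall_measurableSet _),
    tsum_eq_single x]
  · simp
  · intro y hy
    simp [hy]

/-- The indicator function of the vertex `x` as an element of `ℓ²(V, m)`. -/
def indicatorL2 (x : V) : G.L2 :=
  indicatorConstLp 2 (DiscreteMeasurableSpace.forall_measurableSet {x})
    (by rw [vertexMeasure_singleton]; exact ENNReal.coe_ne_top) (1 : ℂ)

theorem indicatorL2_apply (x : V) :
    (G.indicatorL2 x : V → ℂ) = ({x} : Set V).indicator fun _ => 1 :=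
  G.eq_of_ae_eq indicatorConstLp_coeFn

theorem inner_indicatorL2 (x : V) (f : G.L2) :
    inner ℂ (G.indicatorL2 x) f = ((G.m x : ℝ) : ℂ) * f x := by
  rw [indicatorL2, L2.inner_indicatorConstLp_one, integral_singleton]
  simp [Measure.real, vertexMeasure_singleton]

/-- Evaluation at a vertex is a bounded functional on `ℓ²(V, m)`. -/
def evalL2 (x : V) : G.L2 →L[ℂ] ℂ :=
  ((G.m x : ℝ) : ℂ)⁻¹ • innerSL ℂ (G.indicatorL2 x)

@[simp]
theorem evalL2_apply (x : V) (f : G.L2) : G.evalL2 x f = f x := by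
  have := G.ofReal_m_ne_zero x
  simp [evalL2, inner_indicatorL2, this]

variable {G} in
theorem coe_toLp {f : V → ℂ} (hf : MemLp f 2 G.vertexMeasure) : (hf.toLp f : V → ℂ) = f :=
  G.eq_of_ae_eq hf.coeFn_toLp

theorem eq_sum_indicatorL2 {S : Finset V} {f : G.L2} (hf : ∀ x ∉ S, f x = 0) :
    f = ∑ x ∈ S, f x • G.indicatorL2 x := by
  classical
  refine G.L2_ext fun y => ?_
  rw [← G.evalL2_apply y (∑ x ∈ S, _)]
  simp only [map_sum, map_smul, evalL2_apply, indicatorL2_apply, smul_eq_mul,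
    Set.indicator_apply, Set.mem_singleton_iff, mul_ite, mul_one, mul_zero, Finset.sum_ite_eq]
  split_ifs with h
  · rfl
  · exact hf y h

theorem inner_eq_sum {S : Finset V} {f : G.L2} (hf : ∀ x ∉ S, f x = 0) (g : G.L2) :
    inner ℂ f g = ∑ x ∈ S, starRingEnd ℂ (f x) * (((G.m x : ℝ) : ℂ) * g x) := by
  conv_lhs => rw [G.eq_sum_indicatorL2 hf]
  simp only [sum_inner, inner_smul_left, inner_indicatorL2]

theorem norm_sq_eq_sum {S : Finset V} {f : G.L2} (hf : ∀ x ∉ S, f x = 0) :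
    ‖f‖ ^ 2 = ∑ x ∈ S, (G.m x : ℝ) * ‖f x‖ ^ 2 := by
  rw [← inner_self_eq_norm_sq (𝕜 := ℂ), G.inner_eq_sum hf, map_sum]
  refine Finset.sum_congr rfl fun x _ => ?_
  rw [← Complex.normSq_eq_norm_sq]
  simp [Complex.normSq_apply]
  ring

/-- Multiplication by the indicator function of a finite set of vertices. -/
def cutoff (S : Finset V) : G.L2 →L[ℂ] G.L2 :=
  ∑ x ∈ S, (G.evalL2 x).smulRight (G.indicatorL2 x)

open scoped Classical in
theorem cutoff_apply (S : Finset V) (f : G.L2) (y : V) :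
    G.cutoff S f y = if y ∈ S then f y else 0 := by
  rw [← G.evalL2_apply y (G.cutoff S f), cutoff, _root_.sum_apply]
  simp only [map_sum, ContinuousLinearMap.smulRight_apply, map_smul, evalL2_apply,
    indicatorL2_apply, smul_eq_mul, Set.indicator_apply, Set.mem_singleton_iff, mul_ite, mul_one,
    mul_zero, Finset.sum_ite_eq]

theorem cutoff_cutoff (S : Finset V) (f : G.L2) :
    G.cutoff S (G.cutoff S f) = G.cutoff S f :=
  G.L2_ext fun y => by
    classical
    simp only [cutoff_apply]
    split_ifs <;> rfl

theorem cutoff_mem_Cc (S : Finset V) (f : G.L2) : G.cutoff S f ∈ G.Cc := by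
  classical
  refine S.finite_toSet.subset fun y hy => ?_
  rw [Function.mem_support, cutoff_apply] at hy
  by_contra h
  exact hy (if_neg h)

instance finiteDimensional_range_cutoff (S : Finset V) :
    FiniteDimensional ℂ (G.cutoff S).range := by
  have hfin : FiniteDimensional ℂ (Submodule.span ℂ (G.indicatorL2 '' (S : Set V))) :=
    FiniteDimensional.span_of_finite ℂ (S.finite_toSet.image _)
  refine Submodule.finiteDimensional_of_le
    (S₂ := Submodule.span ℂ (G.indicatorL2 '' (S : Set V))) ?_
  rintro _ ⟨f, rfl⟩
  change G.cutoff S f ∈ _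
  rw [cutoff, _root_.sum_apply]
  exact Submodule.sum_mem _ fun x hx =>
    Submodule.smul_mem _ _ (Submodule.subset_span ⟨x, hx, rfl⟩)

theorem laplacian_apply (f : G.laplacian.domain) :
    (G.laplacian f : V → ℂ) = G.lapFun (f : G.L2) :=
  coe_toLp (G.memLp_of_finite_support (G.lapFun_finite_support f.2))

/-- By local finiteness, `Δf(x)` depends on finitely many continuous point evaluations of `f`. The
defining formula therefore persists on the closed graph, which cannot contain `(0, v)` with `v ≠ 0`.
-/
theorem laplacian_isClosable : G.laplacian.IsClosable := by
  refine ⟨G.laplacian.graph.topologicalClosure.toLinearPMap, ?_⟩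
  rw [Submodule.toLinearPMap_graph_eq]
  intro p hp hp0
  refine G.L2_ext fun x => ?_
  let T := (G.locallyFinite x).toFinset
  have hT : ∀ y ∉ T, G.b x y = 0 := fun y hy => by
    by_contra h
    exact hy ((Set.Finite.mem_toFinset _).2 (Or.inl (pos_iff_ne_zero.2 h)))
  have hcl : IsClosed {q : G.L2 × G.L2 | G.evalL2 x q.2 = (1 / ((G.m x : ℝ) : ℂ)) *
      ∑ y ∈ T, ((G.b x y : ℝ) : ℂ) * (G.evalL2 x q.1 - G.evalL2 y q.1)} :=
    isClosed_eq (by fun_prop) (by fun_prop)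
  have hmem : p ∈ {q : G.L2 × G.L2 | G.evalL2 x q.2 = (1 / ((G.m x : ℝ) : ℂ)) *
      ∑ y ∈ T, ((G.b x y : ℝ) : ℂ) * (G.evalL2 x q.1 - G.evalL2 y q.1)} := by
    refine closure_minimal ?_ hcl hp
    intro q hq
    obtain ⟨f, hf1, hf2⟩ := (LinearPMap.mem_graph_iff _).1 hq
    simp only [Set.mem_ofPred_eq, evalL2_apply, ← hf1, ← hf2]
    rw [laplacian_apply, G.lapFun_eq_sum _ hT]
  have h0 : ((0 : G.L2) : V → ℂ) x = 0 := by rw [← evalL2_apply, map_zero]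
  rw [Set.mem_ofPred_eq, hp0] at hmem
  simp only [map_zero, sub_zero, mul_zero, Finset.sum_const_zero] at hmem
  rw [h0, ← evalL2_apply, hmem]

/-- If `lam` belongs to the essential spectrum of the closure of the Laplacian, then there are
approximate eigenfunctions with finite support off any given finite set. -/
theorem exists_approx_eigenfunction {lam : ℂ} (hlam : lam ∈ essSpectrum G.laplacian.closure)
    (S : Finset V) {ε : ℝ} (hε : 0 < ε) :
    ∃ g : G.laplacian.domain, (∀ x ∈ S, (g : G.L2) x = 0) ∧
      ‖G.laplacian g - lam • (g : G.L2)‖ < ε * ‖(g : G.L2)‖ := by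
  classical
  by_contra! hcon
  refine notMem_essSpectrum_closure G.laplacian_isClosable (G.cutoff S) (G.cutoff_cutoff S)
    (G.cutoff_mem_Cc S) lam hε (fun g hg => hcon g fun x hx => ?_) hlam
  have := G.cutoff_apply S g x
  rwa [hg, if_pos hx, ← evalL2_apply, map_zero, eq_comm] at this

end Hilbert

/-! ### Boundary weights as finite sums. -/

open scoped Classical in
/-- The vertices of `S` together with all their neighbours. -/
def closedNhd (S : Finset V) : Finset V :=
  S ∪ S.biUnion fun x => (G.locallyFinite x).toFinset

theorem subset_closedNhd (S : Finset V) : S ⊆ G.closedNhd S := by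
  classical
  exact Finset.subset_union_left

variable {G} in
theorem b_eq_zero_of_notMem_closedNhd {S : Finset V} {x y : V} (hx : x ∈ S)
    (hy : y ∉ G.closedNhd S) : G.b x y = 0 ∧ G.b y x = 0 := by
  classical
  by_contra h
  refine hy (Finset.mem_union_right _ (Finset.mem_biUnion.2 ⟨x, hx, ?_⟩))
  rw [Set.Finite.mem_toFinset, Set.mem_ofPred_eq, pos_iff_ne_zero, pos_iff_ne_zero]
  tauto

theorem sum_closedNhd_out {S : Finset V} {x : V} (hx : x ∈ S) :
    ∑ y ∈ G.closedNhd S, (G.b x y : ℝ) = G.betaOut x := by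
  rw [betaOut, tsum_eq_sum fun y hy => (b_eq_zero_of_notMem_closedNhd hx hy).1]
  push_cast
  rfl

theorem sum_closedNhd_in {S : Finset V} {x : V} (hx : x ∈ S) :
    ∑ y ∈ G.closedNhd S, (G.b y x : ℝ) = G.betaIn x := by
  rw [betaIn, tsum_eq_sum fun y hy => (b_eq_zero_of_notMem_closedNhd hx hy).2]
  push_cast
  rfl

/-- Every edge meeting `U` has both ends in the neighbourhood of `S`, and the indicator difference
selects the boundary edges. Using `S` rather than `U` lets one finite sum serve all level sets in
the coarea inequality. -/
theorem boundaryWeight_eq_ofReal {S U : Finset V} (hU : U ⊆ S) :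
    G.boundaryWeight U = ENNReal.ofReal (∑ x ∈ G.closedNhd S, ∑ y ∈ G.closedNhd S,
      (G.b x y : ℝ) * |(U : Set V).indicator 1 x - (U : Set V).indicator (1 : V → ℝ) y|) := by
  classical
  rw [boundaryWeight, tsum_subtype (G.edgeBoundary U) fun e => (G.b e.1 e.2 : ℝ≥0∞),
    ← Finset.sum_product', ENNReal.ofReal_sum_of_nonneg (fun p _ => by positivity),
    tsum_eq_sum (s := G.closedNhd S ×ˢ G.closedNhd S)]
  · refine Finset.sum_congr rfl fun e _ => ?_
    rw [Set.indicator_apply]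
    by_cases hb : G.b e.1 e.2 = 0
    · simp [hb]
    · by_cases h1 : e.1 ∈ U <;> by_cases h2 : e.2 ∈ U <;>
        simp [edgeBoundary, h1, h2, pos_iff_ne_zero, hb]
  · intro e he
    rw [Finset.mem_product, not_and_or] at he
    refine Set.indicator_of_notMem (fun hmem => hmem.1.ne' ?_) _
    rcases hmem.2 with ⟨h1, -⟩ | ⟨-, h2⟩
    · rcases he with he | he
      · exact absurd (G.subset_closedNhd S (hU h1)) he
      · exact (b_eq_zero_of_notMem_closedNhd (hU h1) he).1
    · rcases he with he | he
      · exact (b_eq_zero_of_notMem_closedNhd (hU h2) he).2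
      · exact absurd (G.subset_closedNhd S (hU h2)) he

/-- The Cheeger constant of `Ω` with respect to vertex weights `w`. -/
def weightedCheeger (w : V → ℝ≥0) (Ω : Set V) : ℝ≥0∞ :=
  ⨅ (U : Finset V) (_ : U.Nonempty) (_ : (U : Set V) ⊆ Ω),
    G.boundaryWeight U / ∑ x ∈ U, (w x : ℝ≥0∞)

theorem boundaryWeight_singleton_le (hbeta : ∀ x, G.betaOut x = G.betaIn x) (x : V) :
    G.boundaryWeight {x} ≤ 2 * G.betaOut x := by
  classical
  rw [← Finset.coe_singleton, G.boundaryWeight_eq_ofReal subset_rfl]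
  have hx : x ∈ ({x} : Finset V) := Finset.mem_singleton_self x
  have hxT := G.subset_closedNhd _ hx
  have h2 : (2 * G.betaOut x : ℝ≥0∞) = ENNReal.ofReal (G.betaOut x + G.betaIn x) := by
    rw [← hbeta, ← two_mul, ENNReal.ofReal_mul zero_le_two]
    simp
  rw [h2]
  refine ENNReal.ofReal_le_ofReal ?_
  calc _ ≤ ∑ u ∈ G.closedNhd {x}, ∑ v ∈ G.closedNhd {x},
        ((G.b u v : ℝ) * (if u = x then 1 else 0) + (G.b u v : ℝ) * (if v = x then 1 else 0)) := by
        gcongr with u _ v _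
        rw [← mul_add]
        gcongr
        by_cases hu : u = x <;> by_cases hv : v = x <;> simp [hu, hv]
    _ = _ := by
        simp only [Finset.sum_add_distrib]
        rw [← G.sum_closedNhd_out hx, ← G.sum_closedNhd_in hx]
        congr 1
        · rw [Finset.sum_comm]
          simp [hxT]
        · simp [hxT]

/-- Testing with a singleton keeps Cheeger constants finite and later settles the case `M_∞ = 0`. -/
theorem weightedCheeger_le (hbeta : ∀ x, G.betaOut x = G.betaIn x) (w : V → ℝ≥0) {Ω : Set V}
    {x : V} (hx : x ∈ Ω) : G.weightedCheeger w Ω ≤ 2 * (G.betaOut x / w x) := by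
  refine (iInf₂_le_of_le {x} (Finset.singleton_nonempty x)
    (iInf_le_of_le (by simpa using hx) le_rfl)).trans ?_
  rw [Finset.sum_singleton, Finset.coe_singleton, ← mul_div_assoc]
  exact ENNReal.div_le_div_right (G.boundaryWeight_singleton_le hbeta x) _

theorem mul_sum_le_of_le_weightedCheeger {w : V → ℝ≥0} {Ω : Set V} {c : ℝ≥0}
    (hc : (c : ℝ≥0∞) ≤ G.weightedCheeger w Ω) {S U : Finset V} (hU : U ⊆ S) (hne : U.Nonempty)
    (hUΩ : (U : Set V) ⊆ Ω) :
    (c : ℝ) * ∑ x ∈ U, (w x : ℝ) ≤ ∑ x ∈ G.closedNhd S, ∑ y ∈ G.closedNhd S,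
      (G.b x y : ℝ) * |(U : Set V).indicator 1 x - (U : Set V).indicator (1 : V → ℝ) y| := by
  have h1 : (c : ℝ≥0∞) ≤ G.boundaryWeight U / ∑ x ∈ U, (w x : ℝ≥0∞) :=
    hc.trans (iInf₂_le_of_le U hne (iInf_le_of_le hUΩ le_rfl))
  have h2 := ENNReal.mul_le_of_le_div h1
  rw [G.boundaryWeight_eq_ofReal hU] at h2
  have h3 := ENNReal.toReal_mono ENNReal.ofReal_ne_top h2
  rw [ENNReal.toReal_ofReal (Finset.sum_nonneg fun x _ => Finset.sum_nonneg fun y _ => by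
    positivity)] at h3
  refine le_trans (le_of_eq ?_) h3
  rw [← ENNReal.ofNNReal_finsetSum, ← ENNReal.coe_mul, ENNReal.coe_toReal]
  push_cast
  rfl

/-! ### Cheeger bounds for the quadratic form. -/

section Hilbert

variable [MeasurableSpace V] [DiscreteMeasurableSpace V]

theorem exists_finset_support (g : G.laplacian.domain) :
    ∃ S : Finset V, ∀ x, x ∈ S ↔ (g : G.L2) x ≠ 0 :=
  ⟨Set.Finite.toFinset (s := Function.support (g : G.L2)) g.2,
    fun _ => Set.Finite.mem_toFinset _⟩

theorem re_inner_laplacian (hbeta : ∀ x, G.betaOut x = G.betaIn x) (g : G.laplacian.domain)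
    {S : Finset V} (hS : ∀ x ∉ S, (g : G.L2) x = 0) :
    (inner ℂ (g : G.L2) (G.laplacian g)).re = 1 / 2 * ∑ x ∈ G.closedNhd S, ∑ y ∈ G.closedNhd S,
      (G.b x y : ℝ) * ‖(g : G.L2) x - (g : G.L2) y‖ ^ 2 := by
  have hmem : ∀ x, (g : G.L2) x ≠ 0 → x ∈ S := fun x hx => by_contra fun h => hx (hS x h)
  rw [G.inner_eq_sum fun x hx => hS x fun h => hx (G.subset_closedNhd S h),
    ← green_formula _ _ (fun x => (G.betaOut x : ℝ)) _
      (fun x _ hx => G.sum_closedNhd_out (hmem x hx))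
      (fun x _ hx => (G.sum_closedNhd_in (hmem x hx)).trans (by rw [hbeta])), Complex.re_sum]
  refine Finset.sum_congr rfl fun x _ => ?_
  by_cases hx : (g : G.L2) x = 0
  · simp [hx]
  · have := G.ofReal_m_ne_zero x
    rw [laplacian_apply,
      G.lapFun_eq_sum _ fun y hy => (b_eq_zero_of_notMem_closedNhd (hmem x hx) hy).1,
      ← mul_assoc _ (1 / _), mul_one_div_cancel this, one_mul]

theorem re_inner_laplacian_nonneg (hbeta : ∀ x, G.betaOut x = G.betaIn x)
    (g : G.laplacian.domain) : 0 ≤ (inner ℂ (g : G.L2) (G.laplacian g)).re := by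
  obtain ⟨S, hS⟩ := G.exists_finset_support g
  rw [G.re_inner_laplacian hbeta g fun x hx => not_not.1 ((hS x).not.1 hx)]
  positivity

/-- Cheeger's inequality, before the vertex weights are compared. -/
theorem weightedCheeger_sq_le (hbeta : ∀ x, G.betaOut x = G.betaIn x) {w : V → ℝ≥0}
    {Ω : Set V} {c : ℝ≥0} (hc : (c : ℝ≥0∞) ≤ G.weightedCheeger w Ω)
    (g : G.laplacian.domain) {S : Finset V} (hS : ∀ x ∉ S, (g : G.L2) x = 0)
    (hSΩ : (S : Set V) ⊆ Ω) :
    (c * ∑ x ∈ S, (w x : ℝ) * ‖(g : G.L2) x‖ ^ 2) ^ 2 ≤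
      8 * (inner ℂ (g : G.L2) (G.laplacian g)).re *
        ∑ x ∈ S, (G.betaOut x : ℝ) * ‖(g : G.L2) x‖ ^ 2 := by
  have hmem : ∀ x, (g : G.L2) x ≠ 0 → x ∈ S := fun x hx => by_contra fun h => hx (hS x h)
  have h1 := coarea_inequality (G.closedNhd S) (b := fun x y => (G.b x y : ℝ))
    (fun x => (w x : ℝ)) c S
    (fun U hU hne => G.mul_sum_le_of_le_weightedCheeger hc hU hne
      ((Finset.coe_subset.2 hU).trans hSΩ))
    (fun x => ‖(g : G.L2) x‖ ^ 2) (fun x => sq_nonneg _) (fun x hx => by simp [hS x hx])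
  have h2 := sq_sum_abs_sub_le (G.closedNhd S) (fun x y => (G.b x y : ℝ))
    (fun x => (G.betaOut x : ℝ)) (g : G.L2) (fun x y => by positivity)
    (fun x _ hx => G.sum_closedNhd_out (hmem x hx))
    (fun x _ hx => (G.sum_closedNhd_in (hmem x hx)).trans (by rw [hbeta]))
  have h3 : ∑ x ∈ S, (G.betaOut x : ℝ) * ‖(g : G.L2) x‖ ^ 2 =
      ∑ x ∈ G.closedNhd S, (G.betaOut x : ℝ) * ‖(g : G.L2) x‖ ^ 2 :=
    Finset.sum_subset (G.subset_closedNhd S) fun x _ hx => by simp [hS x hx]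
  -- The 8 is the 4 from Cauchy–Schwarz times the 2 that undoes the half in Green's formula.
  refine (pow_le_pow_left₀ (by positivity) h1 2).trans (h2.trans (le_of_eq ?_))
  rw [G.re_inner_laplacian hbeta g hS, h3]
  ring

/-- With `w = m` the squared left side is `c²‖g‖⁴`, and `β⁺ ≤ M m` on `Ω` bounds the last factor by
`M‖g‖²`; one `‖g‖²` cancels. Keeping `M` on the right allows `M = 0`. -/
theorem cheeger_inequality (hbeta : ∀ x, G.betaOut x = G.betaIn x) {Ω : Set V} {c M : ℝ≥0}
    (hc : (c : ℝ≥0∞) ≤ G.cheeger Ω) (hM : G.upperRatio Ω ≤ M) (g : G.laplacian.domain)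
    (hg : ∀ x ∉ Ω, (g : G.L2) x = 0) :
    (c : ℝ) ^ 2 / 8 * ‖(g : G.L2)‖ ^ 2 ≤ M * (inner ℂ (g : G.L2) (G.laplacian g)).re := by
  obtain ⟨S, hSg⟩ := G.exists_finset_support g
  have hS : ∀ x ∉ S, (g : G.L2) x = 0 := fun x hx => not_not.1 ((hSg x).not.1 hx)
  have hSΩ : (S : Set V) ⊆ Ω := fun x hx => by_contra fun h => (hSg x).1 hx (hg x h)
  have h1 := G.weightedCheeger_sq_le hbeta (w := G.m) hc g hS hSΩ
  have hQ := G.re_inner_laplacian_nonneg hbeta g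
  have h2 : ∑ x ∈ S, (G.betaOut x : ℝ) * ‖(g : G.L2) x‖ ^ 2 ≤ M * ‖(g : G.L2)‖ ^ 2 := by
    rw [G.norm_sq_eq_sum hS, Finset.mul_sum]
    refine Finset.sum_le_sum fun x hx => ?_
    rw [← mul_assoc]
    gcongr
    have hm : (G.m x : ℝ≥0∞) ≠ 0 := by exact_mod_cast (G.m_pos x).ne'
    have := (le_iSup₂ (f := fun x (_ : x ∈ Ω) => (G.betaOut x : ℝ≥0∞) / G.m x) x
      (hSΩ hx)).trans hM
    rw [ENNReal.div_le_iff hm ENNReal.coe_ne_top] at this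
    exact_mod_cast this
  rw [← G.norm_sq_eq_sum hS] at h1
  rcases (norm_nonneg (g : G.L2)).eq_or_lt with h0 | h0
  · rw [← h0]
    have : 0 ≤ (M : ℝ) * (inner ℂ (g : G.L2) (G.laplacian g)).re := by positivity
    simpa using this
  · have h3 := h1.trans (mul_le_mul_of_nonneg_left h2 (by positivity))
    have h4 : 0 < ‖(g : G.L2)‖ ^ 2 := by positivity
    refine le_of_mul_le_mul_right ?_ h4
    nlinarith

/-- With `w = β⁺` the same sum stands on both sides and cancels once; only then is `β⁺ ≥ a m` used.
-/
theorem cheegerTilde_inequality (hbeta : ∀ x, G.betaOut x = G.betaIn x)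
    {Ω : Set V} {c a : ℝ≥0}
    (hc : (c : ℝ≥0∞) ≤ G.cheegerTilde Ω) (ha : a ≤ G.lowerRatio Ω) (g : G.laplacian.domain)
    (hg : ∀ x ∉ Ω, (g : G.L2) x = 0) :
    (a : ℝ) * ((c : ℝ) ^ 2 / 8) * ‖(g : G.L2)‖ ^ 2 ≤
      (inner ℂ (g : G.L2) (G.laplacian g)).re := by
  obtain ⟨S, hSg⟩ := G.exists_finset_support g
  have hS : ∀ x ∉ S, (g : G.L2) x = 0 := fun x hx => not_not.1 ((hSg x).not.1 hx)
  have hSΩ : (S : Set V) ⊆ Ω := fun x hx => by_contra fun h => (hSg x).1 hx (hg x h)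
  have h1 := G.weightedCheeger_sq_le hbeta (w := G.betaOut) hc g hS hSΩ
  have hQ := G.re_inner_laplacian_nonneg hbeta g
  have h2 : a * ‖(g : G.L2)‖ ^ 2 ≤ ∑ x ∈ S, (G.betaOut x : ℝ) * ‖(g : G.L2) x‖ ^ 2 := by
    rw [G.norm_sq_eq_sum hS, Finset.mul_sum]
    refine Finset.sum_le_sum fun x hx => ?_
    rw [← mul_assoc]
    gcongr
    have := ENNReal.mul_le_of_le_div (ha.trans (iInf₂_le x (hSΩ hx)))
    exact_mod_cast this
  set B := ∑ x ∈ S, (G.betaOut x : ℝ) * ‖(g : G.L2) x‖ ^ 2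
  have hB : 0 ≤ B := le_trans (by positivity) h2
  have h3 : (c : ℝ) ^ 2 * B ≤ 8 * (inner ℂ (g : G.L2) (G.laplacian g)).re := by
    rcases hB.eq_or_lt with h0 | h0
    · rw [← h0, mul_zero]
      positivity
    · refine le_of_mul_le_mul_right ?_ h0
      nlinarith
  have h4 := mul_le_mul_of_nonneg_left h2 (sq_nonneg (c : ℝ))
  linarith

/-- A lower bound for the quadratic form off a finite set bounds the essential spectrum. -/
theorem le_mul_re_of_mem_essSpectrum {lam : ℂ} (hlam : lam ∈ essSpectrum G.laplacian.closure)
    (S : Finset V) {a M : ℝ} (hM : 0 ≤ M)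
    (H : ∀ g : G.laplacian.domain, (∀ x ∈ S, (g : G.L2) x = 0) →
      a * ‖(g : G.L2)‖ ^ 2 ≤ M * (inner ℂ (g : G.L2) (G.laplacian g)).re) :
    a ≤ M * lam.re := by
  refine le_of_forall_pos_le_add fun ε hε => ?_
  -- The error is later multiplied by `M`; dividing by `M + 1` keeps it below `ε` and is safe at `M
  -- = 0`.
  obtain ⟨g, hgS, hg⟩ := G.exists_approx_eigenfunction hlam S (ε := ε / (M + 1)) (by positivity)
  have hpos : 0 < ‖(g : G.L2)‖ := by
    by_contra h
    have h0 : ‖(g : G.L2)‖ = 0 := le_antisymm (not_lt.1 h) (norm_nonneg _)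
    rw [h0, mul_zero] at hg
    exact absurd hg (not_lt.2 (norm_nonneg _))
  have h1 : (inner ℂ (g : G.L2) (G.laplacian g)).re =
      (inner ℂ (g : G.L2) (G.laplacian g - lam • (g : G.L2))).re + lam.re * ‖(g : G.L2)‖ ^ 2 := by
    rw [inner_sub_right, inner_smul_right, inner_self_eq_norm_sq_to_K, Complex.sub_re]
    have : (lam * ((‖(g : G.L2)‖ : ℂ)) ^ 2).re = lam.re * ‖(g : G.L2)‖ ^ 2 := by
      rw [← Complex.ofReal_pow, Complex.re_mul_ofReal]
    refine (eq_sub_iff_add_eq.1 ?_).symm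
    exact congrArg _ this
  have h2 : (inner ℂ (g : G.L2) (G.laplacian g - lam • (g : G.L2))).re ≤
      ε / (M + 1) * ‖(g : G.L2)‖ ^ 2 := by
    calc _ ≤ ‖(g : G.L2)‖ * ‖G.laplacian g - lam • (g : G.L2)‖ := re_inner_le_norm (𝕜 := ℂ) _ _
      _ ≤ ‖(g : G.L2)‖ * (ε / (M + 1) * ‖(g : G.L2)‖) := by gcongr
      _ = _ := by ring
  have h3 : a * ‖(g : G.L2)‖ ^ 2 ≤ M * (ε / (M + 1) + lam.re) * ‖(g : G.L2)‖ ^ 2 := by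
    refine (H g hgS).trans ?_
    rw [mul_assoc]
    refine mul_le_mul_of_nonneg_left ?_ hM
    rw [h1, add_mul]
    linarith
  have h4 := le_of_mul_le_mul_right h3 (by positivity)
  have h5 : M * (ε / (M + 1)) ≤ ε := by
    rw [mul_div_assoc', div_le_iff₀ (by positivity)]
    nlinarith
  linarith

end Hilbert

/-! ### Passage to the limit along the filtration. -/

variable {G} (F : G.Filtration)

theorem Filtration.outer_nonempty [Infinite V] (n : ℕ) : (F.outer n).Nonempty :=
  (F.vert n).finite_toSet.infinite_compl.nonempty

theorem Filtration.cheeger_outer_le [Infinite V] (hbeta : ∀ x, G.betaOut x = G.betaIn x) (n : ℕ) :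
    G.cheeger (F.outer n) ≤ 2 * G.upperRatio (F.outer n) := by
  obtain ⟨x, hx⟩ := F.outer_nonempty n
  refine (G.weightedCheeger_le hbeta G.m hx).trans ?_
  gcongr
  exact le_iSup₂ (f := fun x (_ : x ∈ F.outer n) => (G.betaOut x : ℝ≥0∞) / G.m x) x hx

theorem Filtration.hInf_le [Infinite V] (hbeta : ∀ x, G.betaOut x = G.betaIn x) :
    F.hInf ≤ 2 * F.MInf :=
  le_of_tendsto_of_tendsto' F.tendsto_hInf
    (ENNReal.Tendsto.const_mul F.tendsto_MInf (Or.inr ENNReal.ofNat_ne_top))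
    (F.cheeger_outer_le hbeta)

section Hilbert

variable [MeasurableSpace V] [DiscreteMeasurableSpace V]

variable (G) in
theorem re_nonneg_of_mem_essSpectrum (hbeta : ∀ x, G.betaOut x = G.betaIn x) {lam : ℂ}
    (hlam : lam ∈ essSpectrum G.laplacian.closure) : 0 ≤ lam.re := by
  have := G.le_mul_re_of_mem_essSpectrum hlam ∅ (a := 0) zero_le_one fun g _ => by
    have := G.re_inner_laplacian_nonneg hbeta g
    simpa using this
  simpa using this

theorem Filtration.cheeger_sq_le_of_mem_essSpectrum [Infinite V]
    (hbeta : ∀ x, G.betaOut x = G.betaIn x) {lam : ℂ}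
    (hlam : lam ∈ essSpectrum G.laplacian.closure) {n : ℕ} (hM : G.upperRatio (F.outer n) ≠ ⊤) :
    G.cheeger (F.outer n) ^ 2 / 8 ≤ G.upperRatio (F.outer n) * ENNReal.ofReal lam.re := by
  have hh : G.cheeger (F.outer n) ≠ ⊤ :=
    ne_top_of_le_ne_top (ENNReal.mul_ne_top ENNReal.ofNat_ne_top hM) (F.cheeger_outer_le hbeta n)
  lift G.upperRatio (F.outer n) to ℝ≥0 using hM with M hM'
  lift G.cheeger (F.outer n) to ℝ≥0 using hh with c hc
  have h := G.le_mul_re_of_mem_essSpectrum hlam (F.vert n) M.coe_nonneg fun g hg =>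
    G.cheeger_inequality hbeta hc.le hM'.ge g fun x hx => hg x (by simpa [outer] using hx)
  have h1 := ENNReal.ofReal_le_ofReal h
  rw [ENNReal.ofReal_mul M.coe_nonneg, ENNReal.ofReal_coe_nnreal,
    ENNReal.ofReal_div_of_pos (by norm_num), ENNReal.ofReal_pow c.coe_nonneg,
    ENNReal.ofReal_coe_nnreal] at h1
  simpa using h1

theorem Filtration.cheegerTilde_sq_le_of_mem_essSpectrum [Infinite V]
    (hbeta : ∀ x, G.betaOut x = G.betaIn x) (hout : ∀ x, 0 < G.betaOut x) {lam : ℂ}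
    (hlam : lam ∈ essSpectrum G.laplacian.closure) (n : ℕ) :
    G.lowerRatio (F.outer n) * (G.cheegerTilde (F.outer n) ^ 2 / 8) ≤ ENNReal.ofReal lam.re := by
  obtain ⟨x, hx⟩ := F.outer_nonempty n
  have hβ : (G.betaOut x : ℝ≥0∞) ≠ 0 := by exact_mod_cast (hout x).ne'
  have hm : (G.m x : ℝ≥0∞) ≠ 0 := by exact_mod_cast (G.m_pos x).ne'
  have hh : G.cheegerTilde (F.outer n) ≠ ⊤ :=
    ne_top_of_le_ne_top (ENNReal.mul_ne_top ENNReal.ofNat_ne_top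
      (ENNReal.div_ne_top ENNReal.coe_ne_top hβ)) (G.weightedCheeger_le hbeta G.betaOut hx)
  have hr : G.lowerRatio (F.outer n) ≠ ⊤ :=
    ne_top_of_le_ne_top (ENNReal.div_ne_top ENNReal.coe_ne_top hm) (iInf₂_le x hx)
  lift G.lowerRatio (F.outer n) to ℝ≥0 using hr with a ha
  lift G.cheegerTilde (F.outer n) to ℝ≥0 using hh with c hc
  have h := G.le_mul_re_of_mem_essSpectrum hlam (F.vert n) zero_le_one fun g hg =>
    (G.cheegerTilde_inequality hbeta hc.le ha.le g
      fun x hx => hg x (by simpa [outer] using hx)).trans (one_mul _).ge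
  have h1 := ENNReal.ofReal_le_ofReal h
  rw [one_mul, ENNReal.ofReal_mul a.coe_nonneg, ENNReal.ofReal_coe_nnreal,
    ENNReal.ofReal_div_of_pos (by norm_num), ENNReal.ofReal_pow c.coe_nonneg,
    ENNReal.ofReal_coe_nnreal] at h1
  simpa using h1

theorem Filtration.hInf_sq_le_of_mem_essSpectrum [Infinite V]
    (hbeta : ∀ x, G.betaOut x = G.betaIn x) {lam : ℂ}
    (hlam : lam ∈ essSpectrum G.laplacian.closure) (hM : F.MInf ≠ ⊤) :
    F.hInf ^ 2 / 8 ≤ F.MInf * ENNReal.ofReal lam.re := by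
  have h1 : Tendsto (fun n => G.cheeger (F.outer n) ^ 2 / 8) atTop (𝓝 (F.hInf ^ 2 / 8)) :=
    ENNReal.Tendsto.div_const (ENNReal.Tendsto.pow F.tendsto_hInf) (Or.inr (by norm_num))
  have h2 : Tendsto (fun n => G.upperRatio (F.outer n) * ENNReal.ofReal lam.re) atTop
      (𝓝 (F.MInf * ENNReal.ofReal lam.re)) :=
    ENNReal.Tendsto.mul_const F.tendsto_MInf (Or.inr ENNReal.ofReal_ne_top)
  refine le_of_tendsto_of_tendsto h1 h2 ?_
  -- The bound at stage `n` needs a finite upper ratio, which holds only eventually.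
  filter_upwards [F.tendsto_MInf.eventually_lt_const hM.lt_top] with n hn
  exact F.cheeger_sq_le_of_mem_essSpectrum hbeta hlam hn.ne

theorem Filtration.hTildeInf_sq_le_of_mem_essSpectrum [Infinite V]
    (hbeta : ∀ x, G.betaOut x = G.betaIn x) (hout : ∀ x, 0 < G.betaOut x) {lam : ℂ}
    (hlam : lam ∈ essSpectrum G.laplacian.closure) :
    F.mInf * (F.hTildeInf ^ 2 / 8) ≤ ENNReal.ofReal lam.re := by
  -- Multiplication on `[0,∞]` is discontinuous at `0 · ∞`, so vanishing factors are removed before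
  -- taking the limit.
  by_cases hm : F.mInf = 0
  · simp [hm]
  by_cases hh : F.hTildeInf ^ 2 / 8 = 0
  · simp [hh]
  have h1 : Tendsto (fun n => G.cheegerTilde (F.outer n) ^ 2 / 8) atTop
      (𝓝 (F.hTildeInf ^ 2 / 8)) :=
    ENNReal.Tendsto.div_const (ENNReal.Tendsto.pow F.tendsto_hTildeInf) (Or.inr (by norm_num))
  exact le_of_tendsto' (ENNReal.Tendsto.mul F.tendsto_mInf (Or.inl hm) h1 (Or.inl hh))
    (F.cheegerTilde_sq_le_of_mem_essSpectrum hbeta hout hlam)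

end Hilbert

end WeightedDigraph

theorem EReal.coe_ennreal_ofReal_of_nonneg {x : ℝ} (hx : 0 ≤ x) :
    ((ENNReal.ofReal x : ℝ≥0∞) : EReal) = x := by
  rw [EReal.coe_ennreal_ofReal, max_eq_left hx]

end

theorem mainTheorem2 {V : Type*} [Infinite V] [Countable V]
    [MeasurableSpace V] [DiscreteMeasurableSpace V]
    (G : WeightedDigraph V)
    (hconn : G.ConnectedOn Set.univ)
    (hout : ∀ x, 0 < G.betaOut x) (hin : ∀ x, 0 < G.betaIn x)
    (hbeta : ∀ x, G.betaOut x = G.betaIn x)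
    (F : G.Filtration) :
    G.laplacian.IsClosable ∧
    (¬ (F.MInf = ⊤ ∧ etaEss G.laplacian.closure = 0) →
      ((F.hInf ^ 2 / 8 : ENNReal) : EReal) ≤ (F.MInf : EReal) * etaEss G.laplacian.closure) ∧
    ((F.mInf * (F.hTildeInf ^ 2 / 8) : ENNReal) : EReal) ≤ etaEss G.laplacian.closure := by
  refine ⟨G.laplacian_isClosable, fun hne => ?_, le_iInf₂ fun lam hlam => ?_⟩
  · have hη : 0 ≤ etaEss G.laplacian.closure := le_iInf₂ fun lam hlam =>
      EReal.coe_nonneg.2 (G.re_nonneg_of_mem_essSpectrum hbeta hlam)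
    by_cases hM : F.MInf = ⊤
    · have hpos : 0 < etaEss G.laplacian.closure :=
        lt_of_le_of_ne hη fun h => hne ⟨hM, h.symm⟩
      rw [hM, EReal.coe_ennreal_top, EReal.top_mul_of_pos hpos]
      exact le_top
    -- Division by `M_∞` is impossible here, but `h_∞ ≤ 2 M_∞` makes both sides zero.
    by_cases hM0 : F.MInf = 0
    · have h0 : F.hInf = 0 := by simpa [hM0] using F.hInf_le hbeta
      simp [h0, hM0]
    · have hpos : (0 : EReal) < F.MInf := EReal.coe_ennreal_pos.2 (pos_iff_ne_zero.2 hM0)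
      have htop : (F.MInf : EReal) ≠ ⊤ := by simpa using hM
      -- Moving `M_∞` to the left isolates the infimum, so the bound can be checked at each `λ`; an
      -- empty essential spectrum needs no separate case.
      rw [← EReal.div_le_iff_le_mul hpos htop]
      refine le_iInf₂ fun lam hlam => ?_
      rw [EReal.div_le_iff_le_mul hpos htop,
        ← EReal.coe_ennreal_ofReal_of_nonneg (G.re_nonneg_of_mem_essSpectrum hbeta hlam),
        ← EReal.coe_ennreal_mul, EReal.coe_ennreal_le_coe_ennreal_iff]
      exact F.hInf_sq_le_of_mem_essSpectrum hbeta hlam hM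
  · rw [← EReal.coe_ennreal_ofReal_of_nonneg (G.re_nonneg_of_mem_essSpectrum hbeta hlam),
      EReal.coe_ennreal_le_coe_ennreal_iff]
    exact F.hTildeInf_sq_le_of_mem_essSpectrum hbeta hout hlam
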